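/- Proposition (Linear Canonical Transform of WDF). Let $U_{\rm in}$ be a random complex field on $\mathbb{R}^2$ at a fixed frequency: a jointly measurable map $(\omega,\boldsymbol r)\mapsto U_{\rm in}(\omega,\boldsymbol r)$ on $\Omega\times\mathbb{R}^2$, where $\Omega$ is a probability space and $\langle\cdot\rangle$ denotes expectation, with finite mean energy $\big\langle\int|U_{\rm in}(\boldsymbol r)|^2\,d^2\boldsymbol r\big\rangle<\infty$ (a fully coherent field is the case of a deterministic $U_{\rm in}$). The cross-spectral density of a random field $U$ is $W(\boldsymbol r_1,\boldsymbol r_2)=\langle U^*(\boldsymbol r_1)U(\boldsymbol r_2)\rangle$ and its Wigner distribution function is $$\mathcal W(\boldsymbol r,\boldsymbol p)=\frac1{(2\pi)^2}\int_{\mathbb{R}^2} W\Big(\boldsymbol r-\frac{\Delta\boldsymbol r}2,\boldsymbol r+\frac{\Delta\boldsymbol r}2\Big)e^{-i\boldsymbol p\cdot\Delta\boldsymbol r}\,d^2\Delta\boldsymbol r .$$ Let $S=\begin{pmatrix}A&B\\C&D\end{pmatrix}\in \mathrm{Sp}(4,\mathbb{R})$, with $2\times2$ blocks, i.e. $S^{\top}JS=J$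 for the standard symplectic matrix $J$. A linear canonical transformation described by $S$ is a bounded operator $T$ on $L^2(\mathbb{R}^2)$ of one of the following forms, where $c\in\mathbb{C}$ is any constant with $|c|=1$: * if $\det B\neq0$: the continuous extension to $L^2(\mathbb{R}^2)$ of the Collins integral, defined for Schwartz functions $U$ by $$(TU)(\boldsymbol r)=\frac{c}{2\pi\sqrt{|\det B|}}\int_{\mathbb{R}^2}\exp\Big[\frac i2\big(\boldsymbol r\cdot DB^{-1}\boldsymbol r-2\boldsymbol r'\cdot B^{-1}\boldsymbol r+\boldsymbol r'\cdot B^{-1}A\boldsymbol r'\big)\Big]U(\boldsymbol r')\,d^2\boldsymbol r';$$ * if $B=0$: $(TU)(\boldsymbol r)=c\,|\det A|^{-1/2}\,e^{\frac i2\boldsymbol r\cdot CA^{-1}\boldsymbol r}\,U(A^{-1}\boldsymbol r)$ for $U\in L^2(\mathbb{R}^2)$; * a cascade of finitely many systems of these two kinds: $T=T_n\cdots T_1$, where $T_j$ is described by $S_j\in \mathrm{Sp}(4,\mathbb{R})$ and $S=S_n\cdots S_1$. (Every $S\in \mathrm{Sp}(4,\mathbb{R})$ is a product of two symplectic matrices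 with $\det B\ne0$, so every $S$ is covered.) Let $U_{\rm out}$ be a jointly measurable random field with $U_{\rm out}(\omega,\cdot)=T\,U_{\rm in}(\omega,\cdot)$ in $L^2(\mathbb{R}^2)$ for almost every $\omega$. Then the Wigner distribution functions $\mathcal W_{\rm in},\mathcal W_{\rm out}$ of $U_{\rm in},U_{\rm out}$ satisfy $$\mathcal W_{\rm out}(\boldsymbol\xi)=\mathcal W_{\rm in}(S^{-1}\boldsymbol\xi)\qquad\text{for every }\boldsymbol\xi=(\boldsymbol r,\boldsymbol p)\in\mathbb{R}^4 .$$ -/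

import Mathlib

open MeasureTheory
open scoped SchwartzMap ComplexConjugate

noncomputable section

/-- The transverse plane `ℝ²` (positions `r`, and also momenta `p`), with its Euclidean structure
and Lebesgue measure. -/
abbrev Plane : Type := EuclideanSpace ℝ (Fin 2)

/-- Four-dimensional phase space: `ξ = (r, p) = (x, y, p_x, p_y)`. -/
abbrev PhaseSpace : Type := Fin 2 ⊕ Fin 2 → ℝ

/-- The position part `r` of `ξ = (r, p)`. -/
def PhaseSpace.pos (ξ : PhaseSpace) : Plane := WithLp.toLp 2 fun i => ξ (Sum.inl i)

/-- The momentum part `p` of `ξ = (r, p)`. -/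
def PhaseSpace.mom (ξ : PhaseSpace) : Plane := WithLp.toLp 2 fun i => ξ (Sum.inr i)

/-- Finite-energy fields: `L²(ℝ²; ℂ)`. -/
abbrev FieldSpace : Type := Lp ℂ 2 (volume : Measure Plane)

/-- Real `4 × 4` ray transfer matrices `S = (A B; C D)` with `2 × 2` blocks:
`A = S.toBlocks₁₁`, `B = S.toBlocks₁₂`, `C = S.toBlocks₂₁`, `D = S.toBlocks₂₂`. -/
abbrev RayMatrix : Type := Matrix (Fin 2 ⊕ Fin 2) (Fin 2 ⊕ Fin 2) ℝ

/-- Cross-spectral density `W(r₁, r₂) = ⟨U*(r₁) U(r₂)⟩` of a random field `U` (a fixed frequency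
is understood); the ensemble average is the expectation with respect to `P`. -/
def crossSpectralDensity {Ω : Type*} [MeasurableSpace Ω] (P : Measure Ω) (U : Ω → Plane → ℂ)
    (r₁ r₂ : Plane) : ℂ :=
  ∫ ω, conj (U ω r₁) * U ω r₂ ∂P

/-- Wigner distribution function of a cross-spectral density `W`:
`𝒲(r, p) = (2π)⁻² ∫ W(r - Δ/2, r + Δ/2) e^{-i p·Δ} d²Δ`. -/
def wignerDistribution (W : Plane → Plane → ℂ) (ξ : PhaseSpace) : ℂ :=
  (1 / (2 * (Real.pi : ℂ)) ^ 2) *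
    ∫ Δ : Plane, W (ξ.pos - (1 / 2 : ℝ) • Δ) (ξ.pos + (1 / 2 : ℝ) • Δ) *
      Complex.exp (-Complex.I * ((inner ℝ ξ.mom Δ : ℝ) : ℂ))

/-- The bilinear form `x · M y` of a `2 × 2` matrix `M`. -/
def bilin (M : Matrix (Fin 2) (Fin 2) ℝ) (x y : Plane) : ℝ :=
  inner ℝ x (Matrix.toEuclideanLin M y)

/-- The generalized Huygens (Collins) integral of a system `S = (A B; C D)` with `det B ≠ 0`:
`(2π √|det B|)⁻¹ ∫ exp(i/2 (r·DB⁻¹r - 2 r'·B⁻¹r + r'·B⁻¹A r')) U(r') d²r'`. -/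
def collinsIntegral (S : RayMatrix) (U : Plane → ℂ) (r : Plane) : ℂ :=
  ((1 / (2 * Real.pi * Real.sqrt |S.toBlocks₁₂.det|) : ℝ) : ℂ) *
    ∫ r' : Plane,
      Complex.exp (Complex.I / 2 *
        ((bilin (S.toBlocks₂₂ * S.toBlocks₁₂⁻¹) r r - 2 * bilin S.toBlocks₁₂⁻¹ r' r
          + bilin (S.toBlocks₁₂⁻¹ * S.toBlocks₁₁) r' r' : ℝ) : ℂ)) * U r'

/-- The action of a system `S = (A 0; C D)` (lenses and magnifiers, the case `B = 0`):
`|det A|^{-1/2} exp(i/2 r·CA⁻¹r) U(A⁻¹r)`. -/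
def imagingTransform (S : RayMatrix) (U : Plane → ℂ) (r : Plane) : ℂ :=
  ((1 / Real.sqrt |S.toBlocks₁₁.det| : ℝ) : ℂ) *
    Complex.exp (Complex.I / 2 * ((bilin (S.toBlocks₂₁ * S.toBlocks₁₁⁻¹) r r : ℝ) : ℂ)) *
      U (Matrix.toEuclideanLin S.toBlocks₁₁⁻¹ r)

/-- `IsLinearCanonicalTransform S T`: the bounded operator `T` on finite-energy fields is a linear
canonical transformation described by the symplectic ray matrix `S`. For `det B ≠ 0` it is the
Collins integral, extended continuously from Schwartz functions to `L²`; for `B = 0` it is the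
limiting explicit formula; and the matrix of a cascade of two systems is the product of their
matrices. Since every symplectic matrix is a product of two with `det B ≠ 0`, all symplectic
matrices occur. The operator of `S` is fixed only up to a constant phase factor `c`. -/
inductive IsLinearCanonicalTransform : RayMatrix → (FieldSpace →L[ℂ] FieldSpace) → Prop
  | collins (S : RayMatrix) (hS : S ∈ Matrix.symplecticGroup (Fin 2) ℝ)
      (hB : S.toBlocks₁₂.det ≠ 0) (c : ℂ) (hc : ‖c‖ = 1) (T : FieldSpace →L[ℂ] FieldSpace)
      (hT : ∀ U : 𝓢(Plane, ℂ),
        T (U.toLp 2 volume) =ᵐ[volume] fun r => c * collinsIntegral S U r) :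
      IsLinearCanonicalTransform S T
  | imaging (S : RayMatrix) (hS : S ∈ Matrix.symplecticGroup (Fin 2) ℝ)
      (hB : S.toBlocks₁₂ = 0) (c : ℂ) (hc : ‖c‖ = 1) (T : FieldSpace →L[ℂ] FieldSpace)
      (hT : ∀ U : FieldSpace, T U =ᵐ[volume] fun r => c * imagingTransform S U r) :
      IsLinearCanonicalTransform S T
  | cascade (S₁ S₂ : RayMatrix) (T₁ T₂ : FieldSpace →L[ℂ] FieldSpace)
      (h₁ : IsLinearCanonicalTransform S₁ T₁) (h₂ : IsLinearCanonicalTransform S₂ T₂) :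
      IsLinearCanonicalTransform (S₂ * S₁) (T₂.comp T₁)

end

/-! ### Functions of temperate growth -/

/-! For a deterministic field `f`, the Wigner function is an expectation value of a point
reflection: it equals `π⁻² ⟨R_ξ f, f⟩`, where `R_ξ` is the Grossmann–Royer operator
(`coherentWigner_eq_inner`). Covariance thus reduces to `R_ξ T = T R_{S⁻¹ξ}` together with the
isometry of `T`.

For a Collins system the intertwining is a quadratic identity between phases under `y ↦ 2r' - y`
(`phaseSpaceReflection_collinsIntegral`), and the isometry is Plancherel. Both are used on Schwartz
functions and reach `L²` by density, since `f ↦ ⟨R_ξ f, f⟩` is continuous. For `B = 0` a linear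
change of variables suffices, and cascades follow by induction.

For a random field, Fubini makes the Wigner function the mean of the coherent ones
(`wignerDistribution_crossSpectralDensity`), so the coherent case applies to almost every
realisation. -/

theorem iteratedDeriv_cexp_ofReal_mul_I (n : ℕ) :
    iteratedDeriv n (fun t : ℝ => Complex.exp (t * Complex.I)) =
      fun t : ℝ => Complex.I ^ n * Complex.exp (t * Complex.I) := by
  induction n with
  | zero => simp
  | succ n ih =>
    rw [iteratedDeriv_succ, ih]
    funext t
    have h : HasDerivAt (fun t : ℝ => Complex.exp (t * Complex.I))
        (Complex.exp (t * Complex.I) * (1 * Complex.I)) t :=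
      ((Complex.ofRealCLM.hasDerivAt (x := t)).mul_const Complex.I).cexp
    rw [(h.const_mul _).deriv]
    ring

theorem hasTemperateGrowth_cexp_ofReal_mul_I :
    (fun t : ℝ => Complex.exp (t * Complex.I)).HasTemperateGrowth := by
  -- Every derivative has modulus exactly 1, so growth exponent 0 and constant 1 serve for all
  -- orders.
  refine ⟨(Complex.ofRealCLM.contDiff.mul contDiff_const).cexp, fun n => ⟨0, 1, fun t => ?_⟩⟩
  rw [norm_iteratedFDeriv_eq_norm_iteratedDeriv, iteratedDeriv_cexp_ofReal_mul_I]
  simp [Complex.norm_exp_ofReal_mul_I]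

theorem hasTemperateGrowth_bilin_self (M : Matrix (Fin 2) (Fin 2) ℝ) :
    (fun x => bilin M x x).HasTemperateGrowth :=
  (innerSL ℝ).bilinear_hasTemperateGrowth .id'
    (LinearMap.toContinuousLinearMap (Matrix.toEuclideanLin M)).hasTemperateGrowth

theorem hasTemperateGrowth_chirp (M : Matrix (Fin 2) (Fin 2) ℝ) :
    (fun x => Complex.exp (((1 / 2 * bilin M x x : ℝ) : ℂ) * Complex.I)).HasTemperateGrowth :=
  hasTemperateGrowth_cexp_ofReal_mul_I.comp
    ((Function.HasTemperateGrowth.const (1 / 2 : ℝ)).mul (hasTemperateGrowth_bilin_self M))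

/-! ### Quadratic forms in coordinates -/

theorem inner_plane (x y : Plane) : (inner ℝ x y : ℝ) = x 0 * y 0 + x 1 * y 1 := by
  simp [PiLp.inner_apply, Fin.sum_univ_two, mul_comm]

theorem toEuclideanLin_apply_coord (M : Matrix (Fin 2) (Fin 2) ℝ) (x : Plane) (i : Fin 2) :
    Matrix.toEuclideanLin M x i = M i 0 * x 0 + M i 1 * x 1 := by
  fin_cases i <;> simp [Matrix.toLpLin_apply]

theorem bilin_eq (M : Matrix (Fin 2) (Fin 2) ℝ) (x y : Plane) :
    bilin M x y = x 0 * (M 0 0 * y 0 + M 0 1 * y 1) + x 1 * (M 1 0 * y 0 + M 1 1 * y 1) := by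
  rw [bilin, inner_plane, toEuclideanLin_apply_coord, toEuclideanLin_apply_coord]

/-- The phase of the Collins integral is covariant under the point reflections in corresponding
points `(r', p')` and `(r, p)` of phase space. -/
theorem collins_phase_reflection {Q M N : Matrix (Fin 2) (Fin 2) ℝ} (hQ : Q.transpose = Q)
    (hN : N.transpose = N) {r p r' p' : Plane}
    (hp' : p' = Matrix.toEuclideanLin M r - Matrix.toEuclideanLin N r')
    (hp : p = Matrix.toEuclideanLin Q r - Matrix.toEuclideanLin M.transpose r') (x y : Plane) :
    (bilin Q x x - 2 * bilin M ((2 : ℝ) • r' - y) x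
        + bilin N ((2 : ℝ) • r' - y) ((2 : ℝ) • r' - y)) / 2
        + 2 * inner ℝ p' ((2 : ℝ) • r' - y - r') =
      2 * inner ℝ p (x - r) +
        (bilin Q ((2 : ℝ) • r - x) ((2 : ℝ) • r - x) - 2 * bilin M y ((2 : ℝ) • r - x)
          + bilin N y y) / 2 := by
  have hQ' : Q 1 0 = Q 0 1 := congrFun₂ hQ 0 1
  have hN' : N 1 0 = N 0 1 := congrFun₂ hN 0 1
  subst hp hp'
  simp only [bilin_eq, inner_plane, toEuclideanLin_apply_coord, PiLp.sub_apply, PiLp.smul_apply,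
    smul_eq_mul, Matrix.transpose_apply, hQ', hN']
  ring

/-- The phase of a lens followed by a magnifier is covariant under the point reflections in
corresponding points of phase space. -/
theorem imaging_phase_reflection {A K : Matrix (Fin 2) (Fin 2) ℝ} (hK : K.transpose = K)
    (hA : IsUnit A.det) {r p r' p' : Plane} (hr' : r' = Matrix.toEuclideanLin A⁻¹ r)
    (hp' : p' = Matrix.toEuclideanLin A.transpose (p - Matrix.toEuclideanLin K r)) (x : Plane) :
    2 * inner ℝ p (x - r) + bilin K ((2 : ℝ) • r - x) ((2 : ℝ) • r - x) / 2 - bilin K x x / 2 =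
      2 * inner ℝ p' (Matrix.toEuclideanLin A⁻¹ x - r') := by
  have hK' : K 1 0 = K 0 1 := congrFun₂ hK 0 1
  have key : ∀ u v : Plane, inner ℝ (Matrix.toEuclideanLin A.transpose u)
      (Matrix.toEuclideanLin A⁻¹ v) = inner ℝ u v := by
    intro u v
    have h := Matrix.mul_nonsing_inv A hA
    have h00 := congrFun₂ h 0 0
    have h01 := congrFun₂ h 0 1
    have h10 := congrFun₂ h 1 0
    have h11 := congrFun₂ h 1 1
    simp only [Matrix.mul_apply, Fin.sum_univ_two] at h00 h01 h10 h11
    simp only [inner_plane, toEuclideanLin_apply_coord, Matrix.transpose_apply]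
    simp at h00 h01 h10 h11
    -- The form `u · (A A⁻¹ - 1) v`, expanded entry by entry.
    linear_combination (u 0 * v 0) * h00 + (u 0 * v 1) * h01 + (u 1 * v 0) * h10 +
      (u 1 * v 1) * h11
  subst hp' hr'
  rw [← map_sub, key]
  simp only [bilin_eq, inner_plane, toEuclideanLin_apply_coord, PiLp.sub_apply, PiLp.smul_apply,
    smul_eq_mul, hK']
  ring

/-! ### Block relations of symplectic matrices -/

section Symplectic

open Matrix

variable {S : RayMatrix} (hS : S ∈ Matrix.symplecticGroup (Fin 2) ℝ)

include hS

theorem symplectic_block_relations :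
    S.toBlocks₁₁ᵀ * S.toBlocks₂₁ = S.toBlocks₂₁ᵀ * S.toBlocks₁₁ ∧
    S.toBlocks₁₂ᵀ * S.toBlocks₂₂ = S.toBlocks₂₂ᵀ * S.toBlocks₁₂ ∧
    S.toBlocks₁₁ᵀ * S.toBlocks₂₂ - S.toBlocks₂₁ᵀ * S.toBlocks₁₂ = 1 := by
  rw [← SymplecticGroup.fromBlocks_mem_iff, fromBlocks_toBlocks]
  exact hS

theorem symplectic_block_relation_transpose :
    S.toBlocks₁₁ * S.toBlocks₁₂ᵀ = S.toBlocks₁₂ * S.toBlocks₁₁ᵀ := by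
  -- The upper-left and lower-left blocks of `Sᵀ` are `Aᵀ` and `Bᵀ`.
  have h := symplectic_block_relations (SymplecticGroup.transpose_mem hS)
  exact h.1

theorem toBlocks_mulVec_inv_mulVec (ξ : PhaseSpace) :
    S.toBlocks₁₁.mulVec ((S⁻¹.mulVec ξ) ∘ Sum.inl) + S.toBlocks₁₂.mulVec ((S⁻¹.mulVec ξ) ∘ Sum.inr)
        = ξ ∘ Sum.inl ∧
      S.toBlocks₂₁.mulVec ((S⁻¹.mulVec ξ) ∘ Sum.inl)
        + S.toBlocks₂₂.mulVec ((S⁻¹.mulVec ξ) ∘ Sum.inr) = ξ ∘ Sum.inr := by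
  have h : S.mulVec (S⁻¹.mulVec ξ) = ξ := by
    rw [mulVec_mulVec, mul_nonsing_inv _ (SymplecticGroup.symplectic_det hS), one_mulVec]
  rw [← fromBlocks_toBlocks S, fromBlocks_mulVec, fromBlocks_toBlocks S] at h
  exact ⟨congrArg (· ∘ Sum.inl) h, congrArg (· ∘ Sum.inr) h⟩

section Collins

variable (hB : S.toBlocks₁₂.det ≠ 0)

include hB

theorem transpose_toBlocks₂₂_mul_inv :
    (S.toBlocks₂₂ * S.toBlocks₁₂⁻¹)ᵀ = S.toBlocks₂₂ * S.toBlocks₁₂⁻¹ := by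
  have hu : IsUnit S.toBlocks₁₂.det := isUnit_iff_ne_zero.2 hB
  have hu' : IsUnit S.toBlocks₁₂ᵀ.det := by rwa [det_transpose]
  have h := (symplectic_block_relations hS).2.1
  rw [transpose_mul, transpose_nonsing_inv]
  calc _ = S.toBlocks₁₂ᵀ⁻¹ * (S.toBlocks₂₂ᵀ * S.toBlocks₁₂) * S.toBlocks₁₂⁻¹ := by
        rw [Matrix.mul_assoc, Matrix.mul_assoc, mul_nonsing_inv _ hu, Matrix.mul_one]
    _ = _ := by rw [← h, ← Matrix.mul_assoc, nonsing_inv_mul _ hu', Matrix.one_mul]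

theorem transpose_inv_mul_toBlocks₁₁ :
    (S.toBlocks₁₂⁻¹ * S.toBlocks₁₁)ᵀ = S.toBlocks₁₂⁻¹ * S.toBlocks₁₁ := by
  have hu : IsUnit S.toBlocks₁₂.det := isUnit_iff_ne_zero.2 hB
  have hu' : IsUnit S.toBlocks₁₂ᵀ.det := by rwa [det_transpose]
  have h := symplectic_block_relation_transpose hS
  rw [transpose_mul, transpose_nonsing_inv]
  calc _ = S.toBlocks₁₂⁻¹ * (S.toBlocks₁₂ * S.toBlocks₁₁ᵀ) * S.toBlocks₁₂ᵀ⁻¹ := by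
        rw [← Matrix.mul_assoc, nonsing_inv_mul _ hu, Matrix.one_mul]
    _ = _ := by
        rw [← h, ← Matrix.mul_assoc, Matrix.mul_assoc, mul_nonsing_inv _ hu', Matrix.mul_one]

/-- By symmetry `DB⁻¹ = B⁻ᵀDᵀ`, and the transposed third block relation gives `DᵀA = 1 + BᵀC`. -/
theorem toBlocks₂₂_mul_inv_mul_sub :
    S.toBlocks₂₂ * S.toBlocks₁₂⁻¹ * S.toBlocks₁₁ - S.toBlocks₂₁ = S.toBlocks₁₂⁻¹ᵀ := by
  have hu' : IsUnit S.toBlocks₁₂ᵀ.det := by rw [det_transpose]; exact isUnit_iff_ne_zero.2 hB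
  have h := congrArg transpose (symplectic_block_relations hS).2.2
  simp only [transpose_sub, transpose_mul, transpose_transpose, transpose_one] at h
  rw [← transpose_toBlocks₂₂_mul_inv hS hB, transpose_mul, transpose_nonsing_inv,
    Matrix.mul_assoc, eq_add_of_sub_eq h, Matrix.mul_add, ← Matrix.mul_assoc,
    nonsing_inv_mul _ hu']
  simp

/-- With `(r', p') = S⁻¹(r, p)`, half the quadratic form in the Collins exponent is a generating
function `Φ(r, r')`. This is `p' = -∂Φ/∂r'`, obtained by solving `r = Ar' + Bp'`; the next lemma is
`p = ∂Φ/∂r`. -/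
theorem mom_inv_mulVec_of_det_ne_zero (ξ : PhaseSpace) :
    (PhaseSpace.mom (S⁻¹.mulVec ξ)) = Matrix.toEuclideanLin S.toBlocks₁₂⁻¹ ξ.pos -
      Matrix.toEuclideanLin (S.toBlocks₁₂⁻¹ * S.toBlocks₁₁) (PhaseSpace.pos (S⁻¹.mulVec ξ)) := by
  have h := (toBlocks_mulVec_inv_mulVec hS ξ).1
  have hu : IsUnit S.toBlocks₁₂.det := isUnit_iff_ne_zero.2 hB
  apply WithLp.ofLp_injective 2
  change (S⁻¹.mulVec ξ) ∘ Sum.inr = S.toBlocks₁₂⁻¹.mulVec (ξ ∘ Sum.inl) -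
    (S.toBlocks₁₂⁻¹ * S.toBlocks₁₁).mulVec ((S⁻¹.mulVec ξ) ∘ Sum.inl)
  rw [← h, mulVec_add, mulVec_mulVec, mulVec_mulVec, nonsing_inv_mul _ hu, one_mulVec]
  abel

theorem mom_eq_of_det_ne_zero (ξ : PhaseSpace) :
    ξ.mom = Matrix.toEuclideanLin (S.toBlocks₂₂ * S.toBlocks₁₂⁻¹) ξ.pos -
      Matrix.toEuclideanLin S.toBlocks₁₂⁻¹ᵀ (PhaseSpace.pos (S⁻¹.mulVec ξ)) := by
  have h := toBlocks_mulVec_inv_mulVec hS ξ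
  have hu : IsUnit S.toBlocks₁₂.det := isUnit_iff_ne_zero.2 hB
  apply WithLp.ofLp_injective 2
  change ξ ∘ Sum.inr = (S.toBlocks₂₂ * S.toBlocks₁₂⁻¹).mulVec (ξ ∘ Sum.inl) -
    S.toBlocks₁₂⁻¹ᵀ.mulVec ((S⁻¹.mulVec ξ) ∘ Sum.inl)
  rw [← h.1, ← h.2, ← toBlocks₂₂_mul_inv_mul_sub hS hB, mulVec_add, mulVec_mulVec, mulVec_mulVec,
    nonsing_inv_mul_cancel_right _ _ hu, sub_mulVec]
  abel

end Collins

section Imaging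

variable (hB : S.toBlocks₁₂ = 0)

include hB

theorem transpose_toBlocks₁₁_mul_toBlocks₂₂ : S.toBlocks₁₁ᵀ * S.toBlocks₂₂ = 1 := by
  simpa [hB] using (symplectic_block_relations hS).2.2

theorem isUnit_det_toBlocks₁₁ : IsUnit S.toBlocks₁₁.det := by
  rw [← det_transpose]
  exact isUnit_det_of_right_inverse (transpose_toBlocks₁₁_mul_toBlocks₂₂ hS hB)

theorem transpose_toBlocks₂₁_mul_inv :
    (S.toBlocks₂₁ * S.toBlocks₁₁⁻¹)ᵀ = S.toBlocks₂₁ * S.toBlocks₁₁⁻¹ := by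
  have hu := isUnit_det_toBlocks₁₁ hS hB
  have hu' : IsUnit S.toBlocks₁₁ᵀ.det := by rwa [det_transpose]
  have h := (symplectic_block_relations hS).1
  rw [transpose_mul, transpose_nonsing_inv]
  calc _ = S.toBlocks₁₁ᵀ⁻¹ * (S.toBlocks₂₁ᵀ * S.toBlocks₁₁) * S.toBlocks₁₁⁻¹ := by
        rw [Matrix.mul_assoc, Matrix.mul_assoc, mul_nonsing_inv _ hu, Matrix.mul_one]
    _ = _ := by rw [← h, ← Matrix.mul_assoc, nonsing_inv_mul _ hu', Matrix.one_mul]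

theorem pos_inv_mulVec_of_eq_zero (ξ : PhaseSpace) :
    (PhaseSpace.pos (S⁻¹.mulVec ξ)) = Matrix.toEuclideanLin S.toBlocks₁₁⁻¹ ξ.pos := by
  have h := (toBlocks_mulVec_inv_mulVec hS ξ).1
  apply WithLp.ofLp_injective 2
  change (S⁻¹.mulVec ξ) ∘ Sum.inl = S.toBlocks₁₁⁻¹.mulVec (ξ ∘ Sum.inl)
  rw [← h, hB, zero_mulVec, add_zero, mulVec_mulVec,
    nonsing_inv_mul _ (isUnit_det_toBlocks₁₁ hS hB), one_mulVec]

theorem mom_inv_mulVec_of_eq_zero (ξ : PhaseSpace) :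
    (PhaseSpace.mom (S⁻¹.mulVec ξ)) = Matrix.toEuclideanLin S.toBlocks₁₁ᵀ
      (ξ.mom - Matrix.toEuclideanLin (S.toBlocks₂₁ * S.toBlocks₁₁⁻¹) ξ.pos) := by
  have h := toBlocks_mulVec_inv_mulVec hS ξ
  apply WithLp.ofLp_injective 2
  change (S⁻¹.mulVec ξ) ∘ Sum.inr = S.toBlocks₁₁ᵀ.mulVec
    (ξ ∘ Sum.inr - (S.toBlocks₂₁ * S.toBlocks₁₁⁻¹).mulVec (ξ ∘ Sum.inl))
  rw [← h.1, ← h.2, hB, zero_mulVec, add_zero, mulVec_mulVec,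
    nonsing_inv_mul_cancel_right _ _ (isUnit_det_toBlocks₁₁ hS hB), add_sub_cancel_left,
    mulVec_mulVec, transpose_toBlocks₁₁_mul_toBlocks₂₂ hS hB, one_mulVec]

end Imaging

end Symplectic

/-! ### Reflection in a point of phase space -/

/-- The Grossmann–Royer operator: reflection of a field in the point `ξ = (r, p)` of phase space,
`(R_ξ V)(x) = e^{2i p·(x - r)} V(2r - x)`. -/
noncomputable def phaseSpaceReflection (ξ : PhaseSpace) (V : Plane → ℂ) (x : Plane) : ℂ :=
  Complex.exp (((2 * inner ℝ ξ.mom (x - ξ.pos) : ℝ) : ℂ) * Complex.I) * V ((2 : ℝ) • ξ.pos - x)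

/-- The Wigner distribution function of a deterministic field. -/
noncomputable def coherentWigner (V : Plane → ℂ) (ξ : PhaseSpace) : ℂ :=
  wignerDistribution (fun r₁ r₂ => conj (V r₁) * V r₂) ξ

theorem coherentWigner_integrand (V : Plane → ℂ) (ξ : PhaseSpace) (Δ : Plane) :
    conj (V (ξ.pos - (1 / 2 : ℝ) • Δ)) * V (ξ.pos + (1 / 2 : ℝ) • Δ) *
        Complex.exp (-Complex.I * ((inner ℝ ξ.mom Δ : ℝ) : ℂ)) =
      conj (phaseSpaceReflection ξ V (ξ.pos + (1 / 2 : ℝ) • Δ)) * V (ξ.pos + (1 / 2 : ℝ) • Δ) := by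
  have h : (2 : ℝ) • ξ.pos - (ξ.pos + (1 / 2 : ℝ) • Δ) = ξ.pos - (1 / 2 : ℝ) • Δ := by
    rw [two_smul]; abel
  rw [phaseSpaceReflection, h, map_mul, ← Complex.exp_conj, add_sub_cancel_left, inner_smul_right,
    map_mul, Complex.conj_ofReal, Complex.conj_I]
  have : ((2 * (1 / 2 * inner ℝ ξ.mom Δ) : ℝ) : ℂ) * -Complex.I =
      -Complex.I * ((inner ℝ ξ.mom Δ : ℝ) : ℂ) := by push_cast; ring
  rw [this]
  ring

/-- Substitute `x = r + Δ/2`; the Jacobian 4 in the plane turns `(2π)⁻²` into `π⁻²`. -/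
theorem coherentWigner_eq (V : Plane → ℂ) (ξ : PhaseSpace) :
    coherentWigner V ξ =
      (1 / (Real.pi : ℂ) ^ 2) * ∫ x : Plane, conj (phaseSpaceReflection ξ V x) * V x := by
  have hpi : (Real.pi : ℂ) ≠ 0 := by exact_mod_cast Real.pi_ne_zero
  simp_rw [coherentWigner, wignerDistribution, coherentWigner_integrand]
  rw [Measure.integral_comp_smul volume
      (fun y => conj (phaseSpaceReflection ξ V (ξ.pos + y)) * V (ξ.pos + y)) (1 / 2),
    integral_add_left_eq_self (fun x => conj (phaseSpaceReflection ξ V x) * V x)]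
  rw [finrank_euclideanSpace_fin]
  norm_num
  field_simp
  norm_num

theorem phaseSpaceReflection_const_mul (ξ : PhaseSpace) (c : ℂ) (V : Plane → ℂ) :
    phaseSpaceReflection ξ (fun x => c * V x) = fun x => c * phaseSpaceReflection ξ V x := by
  funext x
  simp only [phaseSpaceReflection]
  ring

theorem phaseSpaceReflection_add (ξ : PhaseSpace) (V W : Plane → ℂ) :
    phaseSpaceReflection ξ (V + W) = phaseSpaceReflection ξ V + phaseSpaceReflection ξ W := by
  funext x
  simp only [phaseSpaceReflection, Pi.add_apply]
  ring

theorem phaseSpaceReflection_congr_ae (ξ : PhaseSpace) {V W : Plane → ℂ} (h : V =ᵐ[volume] W) :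
    phaseSpaceReflection ξ V =ᵐ[volume] phaseSpaceReflection ξ W := by
  have h' := (Measure.measurePreserving_sub_left volume
    ((2 : ℝ) • ξ.pos)).quasiMeasurePreserving.ae_eq_comp h
  filter_upwards [h'] with x hx
  rw [phaseSpaceReflection, phaseSpaceReflection]
  exact congrArg _ hx

theorem coherentWigner_congr_ae {V W : Plane → ℂ} (h : V =ᵐ[volume] W) (ξ : PhaseSpace) :
    coherentWigner V ξ = coherentWigner W ξ := by
  rw [coherentWigner_eq, coherentWigner_eq]
  congr 1
  refine integral_congr_ae ?_
  filter_upwards [h, phaseSpaceReflection_congr_ae ξ h] with x hx hx'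
  rw [hx, hx']

theorem norm_phaseSpaceReflection (ξ : PhaseSpace) (V : Plane → ℂ) (x : Plane) :
    ‖phaseSpaceReflection ξ V x‖ = ‖V ((2 : ℝ) • ξ.pos - x)‖ := by
  rw [phaseSpaceReflection, norm_mul, Complex.norm_exp_ofReal_mul_I, one_mul]

theorem aestronglyMeasurable_phaseSpaceReflection (ξ : PhaseSpace) {V : Plane → ℂ}
    (hV : AEStronglyMeasurable V volume) :
    AEStronglyMeasurable (phaseSpaceReflection ξ V) volume := by
  refine AEStronglyMeasurable.mul (Continuous.aestronglyMeasurable (by fun_prop)) ?_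
  exact hV.comp_measurePreserving (Measure.measurePreserving_sub_left volume ((2 : ℝ) • ξ.pos))

theorem eLpNorm_phaseSpaceReflection (ξ : PhaseSpace) {V : Plane → ℂ}
    (hV : AEStronglyMeasurable V volume) :
    eLpNorm (phaseSpaceReflection ξ V) 2 volume = eLpNorm V 2 volume := by
  rw [← eLpNorm_comp_measurePreserving hV
    (Measure.measurePreserving_sub_left volume ((2 : ℝ) • ξ.pos))]
  exact eLpNorm_congr_norm_ae (.of_forall fun x => norm_phaseSpaceReflection ξ V x)

theorem MeasureTheory.MemLp.phaseSpaceReflection (ξ : PhaseSpace) {V : Plane → ℂ}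
    (hV : MemLp V 2 volume) : MemLp (phaseSpaceReflection ξ V) 2 volume :=
  ⟨aestronglyMeasurable_phaseSpaceReflection ξ hV.1, by
    rw [eLpNorm_phaseSpaceReflection ξ hV.1]; exact hV.2⟩

/-- The Grossmann–Royer operator as a linear isometry of `L²`. -/
noncomputable def phaseSpaceReflectionL2 (ξ : PhaseSpace) : FieldSpace →ₗᵢ[ℂ] FieldSpace where
  toFun f := ((Lp.memLp f).phaseSpaceReflection ξ).toLp (phaseSpaceReflection ξ f)
  map_add' f g := by
    rw [← MemLp.toLp_add]
    refine MemLp.toLp_congr _ _ ?_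
    rw [← phaseSpaceReflection_add]
    exact phaseSpaceReflection_congr_ae ξ (Lp.coeFn_add f g)
  map_smul' c f := by
    rw [RingHom.id_apply, ← MemLp.toLp_const_smul]
    refine MemLp.toLp_congr _ _ ?_
    exact (phaseSpaceReflection_congr_ae ξ (Lp.coeFn_smul c f)).trans
      (.of_eq (phaseSpaceReflection_const_mul ξ c f))
  norm_map' f := by
    change ‖((Lp.memLp f).phaseSpaceReflection ξ).toLp _‖ = ‖f‖
    rw [Lp.norm_toLp, eLpNorm_phaseSpaceReflection ξ (Lp.memLp f).1, Lp.norm_def]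

theorem coeFn_phaseSpaceReflectionL2 (ξ : PhaseSpace) (f : FieldSpace) :
    phaseSpaceReflectionL2 ξ f =ᵐ[volume] phaseSpaceReflection ξ f :=
  ((Lp.memLp f).phaseSpaceReflection ξ).coeFn_toLp

theorem coherentWigner_eq_inner (f : FieldSpace) (ξ : PhaseSpace) :
    coherentWigner f ξ = (1 / (Real.pi : ℂ) ^ 2) * inner ℂ (phaseSpaceReflectionL2 ξ f) f := by
  rw [coherentWigner_eq, L2.inner_def]
  congr 1
  refine integral_congr_ae ?_
  filter_upwards [coeFn_phaseSpaceReflectionL2 ξ f] with x hx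
  rw [hx, RCLike.inner_apply, mul_comm]

theorem continuous_coherentWigner (ξ : PhaseSpace) :
    Continuous fun f : FieldSpace => coherentWigner f ξ := by
  simp_rw [coherentWigner_eq_inner]
  exact continuous_const.mul ((phaseSpaceReflectionL2 ξ).continuous.inner continuous_id)

/-- Needed because the Collins formula for `T` is available only on Schwartz functions, and it has
to be applied to a reflected one. -/
theorem exists_schwartzMap_eq_phaseSpaceReflection (ξ : PhaseSpace) (U : 𝓢(Plane, ℂ)) :
    ∃ V : 𝓢(Plane, ℂ), (V : Plane → ℂ) = phaseSpaceReflection ξ U := by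
  have hg : (fun x : Plane =>
      Complex.exp (((2 * inner ℝ ξ.mom (x - ξ.pos) : ℝ) : ℂ) * Complex.I)).HasTemperateGrowth :=
    hasTemperateGrowth_cexp_ofReal_mul_I.comp ((Function.HasTemperateGrowth.const (2 : ℝ)).mul
      ((Function.hasTemperateGrowth_inner_right ξ.mom).comp
        (Function.HasTemperateGrowth.id'.sub (Function.HasTemperateGrowth.const ξ.pos))))
  refine ⟨SchwartzMap.smulLeftCLM ℂ (fun x : Plane =>
    Complex.exp (((2 * inner ℝ ξ.mom (x - ξ.pos) : ℝ) : ℂ) * Complex.I))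
    (SchwartzMap.compSubConstCLM ℂ ((2 : ℝ) • ξ.pos)
    (SchwartzMap.compCLMOfContinuousLinearEquiv ℂ (ContinuousLinearEquiv.neg ℝ) U)), ?_⟩
  rw [SchwartzMap.smulLeftCLM_apply hg]
  funext x
  simp [phaseSpaceReflection]

/-! ### Change of variables and energy -/

theorem integral_comp_toEuclideanLin {E : Type*} [NormedAddCommGroup E] [NormedSpace ℝ E]
    {M : Matrix (Fin 2) (Fin 2) ℝ} (hM : M.det ≠ 0) (f : Plane → E) :
    ∫ x, f (Matrix.toEuclideanLin M x) = |M.det|⁻¹ • ∫ x, f x := by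
  have hdet : LinearMap.det (Matrix.toEuclideanLin M) = M.det := LinearMap.det_toLpLin 2 M
  have hd : LinearMap.det (Matrix.toEuclideanLin M) ≠ 0 := by rwa [hdet]
  have h := Measure.map_linearMap_addHaar_eq_smul_addHaar (volume : Measure Plane) hd
  -- As a homeomorphism, the map allows a change of variables with no measurability assumption on
  -- `f`.
  let e := (LinearEquiv.ofIsUnitDet (f := Matrix.toEuclideanLin M)
    (v := Module.finBasis ℝ Plane) (v' := Module.finBasis ℝ Plane)
    (by rw [LinearMap.det_toMatrix]; exact isUnit_iff_ne_zero.2 hd)).toContinuousLinearEquiv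
  calc ∫ x, f (Matrix.toEuclideanLin M x)
      = ∫ y, f y ∂(Measure.map (Matrix.toEuclideanLin M) volume) :=
        (integral_map_equiv e.toHomeomorph.toMeasurableEquiv f).symm
    _ = _ := by
        rw [h, integral_smul_measure, hdet, ENNReal.toReal_ofReal (abs_nonneg _), abs_inv]

theorem norm_sq_eq_integral (f : FieldSpace) : ‖f‖ ^ 2 = ∫ x, ‖f x‖ ^ 2 := by
  have h : ((‖f‖ ^ 2 : ℝ) : ℂ) = ((∫ x, ‖f x‖ ^ 2 : ℝ) : ℂ) := by
    rw [← integral_complex_ofReal]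
    rw [Complex.ofReal_pow]
    refine (inner_self_eq_norm_sq_to_K (𝕜 := ℂ) f).symm.trans ?_
    rw [L2.inner_def]
    refine integral_congr_ae (.of_forall fun x => ?_)
    exact (inner_self_eq_norm_sq_to_K (𝕜 := ℂ) (f x)).trans (Complex.ofReal_pow _ 2).symm
  exact_mod_cast h

/-! ### The Collins integral -/

/-- The substitution `y ↦ 2r' - y` matches the integrands pointwise, so no integrability of `U` is
needed. -/
theorem phaseSpaceReflection_collinsIntegral {S : RayMatrix}
    (hS : S ∈ Matrix.symplecticGroup (Fin 2) ℝ) (hB : S.toBlocks₁₂.det ≠ 0) (ξ : PhaseSpace)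
    (U : Plane → ℂ) :
    phaseSpaceReflection ξ (collinsIntegral S U) =
      collinsIntegral S (phaseSpaceReflection (S⁻¹.mulVec ξ) U) := by
  funext x
  have key := collins_phase_reflection (transpose_toBlocks₂₂_mul_inv hS hB)
    (transpose_inv_mul_toBlocks₁₁ hS hB) (mom_inv_mulVec_of_det_ne_zero hS hB ξ)
    (mom_eq_of_det_ne_zero hS hB ξ) x
  rw [phaseSpaceReflection, collinsIntegral, collinsIntegral, mul_left_comm,
    ← integral_const_mul]
  congr 1
  symm
  rw [← integral_sub_left_eq_self _ volume ((2 : ℝ) • PhaseSpace.pos (S⁻¹.mulVec ξ))]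
  refine integral_congr_ae (.of_forall fun y => ?_)
  simp only [phaseSpaceReflection, sub_sub_cancel]
  rw [← mul_assoc, ← mul_assoc, ← Complex.exp_add, ← Complex.exp_add]
  have h := congrArg (fun t : ℝ => Complex.exp (t * Complex.I) * U y) (key y)
  refine Eq.trans ?_ (h.trans ?_) <;>
  · congr 2
    push_cast
    ring

/-- Chirp, Fourier transform, chirp. The factor `(2π)⁻¹` comes from the convention `e^{-2πi⟨y, w⟩}`
of the Fourier transform. -/
theorem collinsIntegral_eq_fourier (S : RayMatrix) (U V : 𝓢(Plane, ℂ))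
    (hV : ∀ x, V x = Complex.exp
      (((1 / 2 * bilin (S.toBlocks₁₂⁻¹ * S.toBlocks₁₁) x x : ℝ) : ℂ) * Complex.I) * U x)
    (r : Plane) :
    collinsIntegral S U r = ((1 / (2 * Real.pi * Real.sqrt |S.toBlocks₁₂.det|) : ℝ) : ℂ) *
      (Complex.exp (((1 / 2 * bilin (S.toBlocks₂₂ * S.toBlocks₁₂⁻¹) r r : ℝ) : ℂ) * Complex.I) *
        FourierTransform.fourier V
          (Matrix.toEuclideanLin ((2 * Real.pi)⁻¹ • S.toBlocks₁₂⁻¹) r)) := by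
  rw [collinsIntegral, SchwartzMap.fourier_coe, Real.fourier_eq']
  congr 1
  rw [← integral_const_mul]
  refine integral_congr_ae (.of_forall fun y => ?_)
  simp only [hV, smul_eq_mul]
  rw [← mul_assoc, ← mul_assoc, ← Complex.exp_add, ← Complex.exp_add]
  congr 2
  rw [map_smul, LinearMap.smul_apply, inner_smul_right, bilin, bilin, bilin]
  have hpi : (Real.pi : ℂ) ≠ 0 := by exact_mod_cast Real.pi_ne_zero
  push_cast
  field_simp
  ring

/-- Chirps are unimodular and Plancherel handles the transform; the Jacobian `(2π)² |det B|` cancels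
the squared prefactor. -/
theorem integral_norm_sq_collinsIntegral {S : RayMatrix} (hB : S.toBlocks₁₂.det ≠ 0)
    (U : 𝓢(Plane, ℂ)) : ∫ r, ‖collinsIntegral S U r‖ ^ 2 = ∫ r, ‖U r‖ ^ 2 := by
  have hg := hasTemperateGrowth_chirp (S.toBlocks₁₂⁻¹ * S.toBlocks₁₁)
  obtain ⟨V, hV⟩ : ∃ V : 𝓢(Plane, ℂ), ∀ x, V x = Complex.exp
      (((1 / 2 * bilin (S.toBlocks₁₂⁻¹ * S.toBlocks₁₁) x x : ℝ) : ℂ) * Complex.I) * U x :=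
    ⟨SchwartzMap.smulLeftCLM ℂ (fun x => Complex.exp
      (((1 / 2 * bilin (S.toBlocks₁₂⁻¹ * S.toBlocks₁₁) x x : ℝ) : ℂ) * Complex.I)) U,
      fun x => SchwartzMap.smulLeftCLM_apply_apply hg U x⟩
  have hpos : 0 < |S.toBlocks₁₂.det| := abs_pos.2 hB
  have hdet : ((2 * Real.pi)⁻¹ • S.toBlocks₁₂⁻¹).det =
      ((2 * Real.pi)⁻¹) ^ 2 * S.toBlocks₁₂.det⁻¹ := by
    rw [Matrix.det_smul, Matrix.det_nonsing_inv, Ring.inverse_eq_inv', Fintype.card_fin]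
  have hdet0 : ((2 * Real.pi)⁻¹ • S.toBlocks₁₂⁻¹).det ≠ 0 := by
    rw [hdet]
    exact mul_ne_zero (pow_ne_zero _ (inv_ne_zero Real.two_pi_pos.ne')) (inv_ne_zero hB)
  simp_rw [collinsIntegral_eq_fourier S U V hV, norm_mul, Complex.norm_exp_ofReal_mul_I, one_mul,
    mul_pow]
  rw [integral_const_mul, integral_comp_toEuclideanLin hdet0
    (fun w => ‖FourierTransform.fourier V w‖ ^ 2), SchwartzMap.integral_norm_sq_fourier]
  simp_rw [hV, norm_mul, Complex.norm_exp_ofReal_mul_I, one_mul]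
  rw [hdet, abs_mul, abs_inv, abs_of_nonneg (by positivity : 0 ≤ (2 * Real.pi)⁻¹ ^ 2),
    Complex.norm_real, Real.norm_eq_abs, sq_abs, div_pow, mul_pow,
    Real.sq_sqrt hpos.le, smul_eq_mul, ← mul_assoc]
  have := Real.pi_ne_zero
  field_simp

section Collins

variable {S : RayMatrix} (hB : S.toBlocks₁₂.det ≠ 0) {c : ℂ} (hc : ‖c‖ = 1)
  {T : FieldSpace →L[ℂ] FieldSpace}
  (hT : ∀ U : 𝓢(Plane, ℂ), T (U.toLp 2 volume) =ᵐ[volume] fun r => c * collinsIntegral S U r)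

include hB hc hT

theorem norm_map_of_collins (f : FieldSpace) : ‖T f‖ = ‖f‖ := by
  refine (SchwartzMap.denseRange_toLpCLM (E := Plane) (F := ℂ) (p := 2) (by simp)
    (μ := volume)).induction_on (p := fun f : FieldSpace => ‖T f‖ = ‖f‖) f
    (isClosed_eq T.continuous.norm continuous_norm) fun U => ?_
  rw [SchwartzMap.toLpCLM_apply, ← sq_eq_sq₀ (norm_nonneg _) (norm_nonneg _),
    norm_sq_eq_integral, norm_sq_eq_integral]
  trans ∫ r, ‖collinsIntegral S U r‖ ^ 2
  · refine integral_congr_ae ?_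
    filter_upwards [hT U] with r hr
    rw [hr, norm_mul, hc, one_mul]
  · rw [integral_norm_sq_collinsIntegral hB]
    refine integral_congr_ae ?_
    filter_upwards [U.coeFn_toLp 2 volume] with r hr
    rw [hr]

theorem coherentWigner_of_collins (hS : S ∈ Matrix.symplecticGroup (Fin 2) ℝ) (f : FieldSpace)
    (ξ : PhaseSpace) : coherentWigner (T f) ξ = coherentWigner f (S⁻¹.mulVec ξ) := by
  refine (SchwartzMap.denseRange_toLpCLM (E := Plane) (F := ℂ) (p := 2) (by simp)
    (μ := volume)).induction_on
    (p := fun f : FieldSpace => coherentWigner (T f) ξ = coherentWigner f (S⁻¹.mulVec ξ)) f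
    (isClosed_eq ((continuous_coherentWigner ξ).comp T.continuous)
      (continuous_coherentWigner _)) fun U => ?_
  rw [SchwartzMap.toLpCLM_apply]
  obtain ⟨V, hV⟩ := exists_schwartzMap_eq_phaseSpaceReflection (S⁻¹.mulVec ξ) U
  have hU : phaseSpaceReflectionL2 (S⁻¹.mulVec ξ) (U.toLp 2 volume) = V.toLp 2 volume := by
    refine Lp.ext ?_
    refine (coeFn_phaseSpaceReflectionL2 _ _).trans (.trans ?_ (V.coeFn_toLp 2 volume).symm)
    rw [hV]
    exact phaseSpaceReflection_congr_ae _ (U.coeFn_toLp 2 volume)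
  have hTU : phaseSpaceReflectionL2 ξ (T (U.toLp 2 volume)) = T (V.toLp 2 volume) := by
    refine Lp.ext ?_
    refine (coeFn_phaseSpaceReflectionL2 _ _).trans (.trans ?_ (hT V).symm)
    refine (phaseSpaceReflection_congr_ae _ (hT U)).trans (.of_eq ?_)
    rw [phaseSpaceReflection_const_mul, phaseSpaceReflection_collinsIntegral hS hB, hV]
  -- By polarisation, preserving norms means preserving inner products.
  let Ti : FieldSpace →ₗᵢ[ℂ] FieldSpace := ⟨T, norm_map_of_collins hB hc hT⟩
  rw [coherentWigner_eq_inner, coherentWigner_eq_inner, hU, hTU]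
  exact congrArg _ (Ti.inner_map_map _ _)

end Collins

/-! ### Imaging systems -/

theorem coherentWigner_imagingTransform {S : RayMatrix}
    (hS : S ∈ Matrix.symplecticGroup (Fin 2) ℝ) (hB : S.toBlocks₁₂ = 0) {c : ℂ} (hc : ‖c‖ = 1)
    (U : Plane → ℂ) (ξ : PhaseSpace) :
    coherentWigner (fun r => c * imagingTransform S U r) ξ =
      coherentWigner U (S⁻¹.mulVec ξ) := by
  have hA := isUnit_det_toBlocks₁₁ hS hB
  have hpos : 0 < |S.toBlocks₁₁.det| := abs_pos.2 hA.ne_zero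
  have hdet : S.toBlocks₁₁⁻¹.det = S.toBlocks₁₁.det⁻¹ := by
    rw [Matrix.det_nonsing_inv, Ring.inverse_eq_inv']
  have hr := pos_inv_mulVec_of_eq_zero hS hB ξ
  have key := imaging_phase_reflection (transpose_toBlocks₂₁_mul_inv hS hB) hA hr
    (mom_inv_mulVec_of_eq_zero hS hB ξ)
  have hcc : conj c * c = 1 := by
    rw [mul_comm, Complex.mul_conj, Complex.normSq_eq_norm_sq, hc]; simp
  have hsq : (((1 / Real.sqrt |S.toBlocks₁₁.det| : ℝ) : ℂ)) *
      ((1 / Real.sqrt |S.toBlocks₁₁.det| : ℝ) : ℂ) = ((|S.toBlocks₁₁.det|⁻¹ : ℝ) : ℂ) := by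
    rw [← Complex.ofReal_mul, div_mul_div_comm, Real.mul_self_sqrt hpos.le, one_mul, one_div]
  rw [coherentWigner_eq, coherentWigner_eq]
  congr 1
  -- The integrands agree pointwise up to the Jacobian, so `U` may be arbitrary.
  have hpt : ∀ x, conj (phaseSpaceReflection ξ (fun r => c * imagingTransform S U r) x) *
      (c * imagingTransform S U x) = ((|S.toBlocks₁₁.det|⁻¹ : ℝ) : ℂ) *
        (fun y => conj (phaseSpaceReflection (S⁻¹.mulVec ξ) U y) * U y)
          (Matrix.toEuclideanLin S.toBlocks₁₁⁻¹ x) := by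
    intro x
    have h2 : Matrix.toEuclideanLin S.toBlocks₁₁⁻¹ ((2 : ℝ) • ξ.pos - x) =
        (2 : ℝ) • PhaseSpace.pos (S⁻¹.mulVec ξ) - Matrix.toEuclideanLin S.toBlocks₁₁⁻¹ x := by
      rw [hr, map_sub, map_smul]
    simp only [phaseSpaceReflection, imagingTransform, h2, map_mul, ← Complex.exp_conj,
      Complex.conj_ofReal, Complex.conj_I, map_div₀, map_ofNat]
    rw [← key x, ← hsq]
    have hexp : ∀ a b d : ℝ, Complex.exp (((a + b / 2 - d / 2 : ℝ) : ℂ) * -Complex.I) =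
        Complex.exp (a * -Complex.I) * Complex.exp (-Complex.I / 2 * b) *
          Complex.exp (Complex.I / 2 * d) := by
      intro a b d
      rw [← Complex.exp_add, ← Complex.exp_add]
      push_cast
      ring_nf
    rw [hexp]
    refine Eq.trans (b := (conj c * c) * _) ?_ (by rw [hcc, one_mul])
    ring
  simp_rw [hpt]
  rw [integral_const_mul, integral_comp_toEuclideanLin (by rw [hdet]; exact inv_ne_zero hA.ne_zero)
    (fun y => conj (phaseSpaceReflection (S⁻¹.mulVec ξ) U y) * U y), hdet, abs_inv, inv_inv,
    Complex.real_smul, ← mul_assoc, ← Complex.ofReal_mul, inv_mul_cancel₀ hpos.ne']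
  simp

theorem IsLinearCanonicalTransform.coherentWigner_eq {S : RayMatrix}
    {T : FieldSpace →L[ℂ] FieldSpace} (hT : IsLinearCanonicalTransform S T) (f : FieldSpace)
    (ξ : PhaseSpace) : coherentWigner (T f) ξ = coherentWigner f (S⁻¹.mulVec ξ) := by
  induction hT generalizing f ξ with
  | collins S hS hB c hc T hT => exact coherentWigner_of_collins hB hc hT hS f ξ
  | imaging S hS hB c hc T hT =>
    rw [coherentWigner_congr_ae (hT f), coherentWigner_imagingTransform hS hB hc]
  | cascade S₁ S₂ T₁ T₂ _ _ ih₁ ih₂ =>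
    rw [ContinuousLinearMap.comp_apply, ih₂, ih₁, Matrix.mul_inv_rev, Matrix.mulVec_mulVec]

/-! ### Random fields -/

section RandomField

variable {Ω : Type*} [MeasurableSpace Ω] {P : Measure Ω} {U : Ω → Plane → ℂ}

theorem memLp_uncurry_comp_affine [SFinite P] (hU : MemLp (Function.uncurry U) 2 (P.prod volume))
    (a : Plane) {s : ℝ} (hs : s ≠ 0) :
    MemLp (fun z : Ω × Plane => U z.1 (a + s • z.2)) 2 (P.prod volume) := by
  have hmp : MeasurePreserving (fun x : Plane => a + s • x) volume
      (ENNReal.ofReal |(s ^ Module.finrank ℝ Plane)⁻¹| • volume) := by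
    refine ⟨by fun_prop, ?_⟩
    change Measure.map ((fun x => a + x) ∘ fun x => s • x) volume = _
    rw [← Measure.map_map (by fun_prop) (by fun_prop), Measure.map_addHaar_smul _ hs,
      Measure.map_smul, map_add_left_eq_self]
  have hprod := (MeasurePreserving.id P).prod hmp
  refine MemLp.comp_measurePreserving (g := Function.uncurry U) ?_ hprod
  rw [Measure.prod_smul_right]
  exact hU.smul_measure ENNReal.ofReal_ne_top

/-- Fubini applies: the integrand is a product of two jointly `L²` functions, the field at `r ∓
Δ/2`, and a unimodular factor. -/
theorem wignerDistribution_crossSpectralDensity [SFinite P]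
    (hU : MemLp (Function.uncurry U) 2 (P.prod volume)) (ξ : PhaseSpace) :
    wignerDistribution (crossSpectralDensity P U) ξ = ∫ ω, coherentWigner (U ω) ξ ∂P := by
  have h₁ := memLp_uncurry_comp_affine hU ξ.pos (s := -(1 / 2)) (by norm_num)
  have h₂ := memLp_uncurry_comp_affine hU ξ.pos (s := 1 / 2) (by norm_num)
  have h₃ : Integrable (fun z : Ω × Plane => conj (U z.1 (ξ.pos + (-(1 / 2) : ℝ) • z.2)) *
      U z.1 (ξ.pos + (1 / 2 : ℝ) • z.2)) (P.prod volume) := h₁.star.integrable_mul h₂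
  have h₄ : Integrable (Function.uncurry fun ω Δ => conj (U ω (ξ.pos - (1 / 2 : ℝ) • Δ)) *
      U ω (ξ.pos + (1 / 2 : ℝ) • Δ) * Complex.exp (-Complex.I * ((inner ℝ ξ.mom Δ : ℝ) : ℂ)))
      (P.prod volume) := by
    refine (h₃.mul_bdd (c := 1) (g := fun z : Ω × Plane =>
      Complex.exp (-Complex.I * ((inner ℝ ξ.mom z.2 : ℝ) : ℂ)))
      (Measurable.aestronglyMeasurable (by fun_prop)) (.of_forall fun z => ?_)).congr
      (.of_forall fun z => ?_)
    · rw [Complex.norm_exp]; simp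
    · simp [Function.uncurry, sub_eq_add_neg]
  simp_rw [coherentWigner, wignerDistribution, crossSpectralDensity]
  rw [integral_const_mul]
  congr 1
  simp_rw [← integral_mul_const]
  exact (integral_integral_swap h₄).symm

/-- The energy of each output realisation is at most `‖T‖²` times that of the input, whose mean is
finite. This gives the output the joint integrability that Fubini requires. -/
theorem memLp_uncurry_of_bounded_operator {V : Ω → Plane → ℂ} (T : FieldSpace →L[ℂ] FieldSpace)
    (hU : MemLp (Function.uncurry U) 2 (P.prod volume))
    (hV : AEStronglyMeasurable (Function.uncurry V) (P.prod volume))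
    (hUV : ∀ᵐ ω ∂P, ∃ h : MemLp (U ω) 2 volume, V ω =ᵐ[volume] T (h.toLp (U ω))) :
    MemLp (Function.uncurry V) 2 (P.prod volume) := by
  have hU' := ((memLp_two_iff_integrable_sq_norm hU.1).1 hU).integral_prod_left
  have hVm : AEStronglyMeasurable (fun z : Ω × Plane => ‖Function.uncurry V z‖ ^ 2)
      (P.prod volume) := hV.norm.pow 2
  rw [memLp_two_iff_integrable_sq_norm hV, integrable_prod_iff hVm]
  constructor
  · filter_upwards [hUV] with ω ⟨h, hω⟩
    have hm : MemLp (V ω) 2 volume := (memLp_congr_ae hω).2 (Lp.memLp _)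
    exact (memLp_two_iff_integrable_sq_norm hm.1).1 hm
  · refine (hU'.const_mul (‖T‖ ^ 2)).mono' hVm.norm.integral_prod_right' ?_
    filter_upwards [hUV] with ω ⟨h, hω⟩
    have e₁ : ∫ r, ‖V ω r‖ ^ 2 = ‖T (h.toLp (U ω))‖ ^ 2 := by
      rw [norm_sq_eq_integral]
      refine integral_congr_ae ?_
      filter_upwards [hω] with r hr
      rw [hr]
    have e₂ : ∫ r, ‖U ω r‖ ^ 2 = ‖h.toLp (U ω)‖ ^ 2 := by
      rw [norm_sq_eq_integral]
      refine integral_congr_ae ?_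
      filter_upwards [h.coeFn_toLp] with r hr
      rw [hr]
    simp only [Function.uncurry, norm_pow, norm_norm]
    rw [Real.norm_of_nonneg (integral_nonneg fun _ => sq_nonneg _), e₁, e₂, ← mul_pow]
    exact pow_le_pow_left₀ (norm_nonneg _) (T.le_opNorm _) 2

end RandomField

theorem mainTheorem7 {Ω : Type*} [MeasurableSpace Ω] (P : Measure Ω) [IsProbabilityMeasure P]
    (S : RayMatrix) (hS : S ∈ Matrix.symplecticGroup (Fin 2) ℝ)
    (T : FieldSpace →L[ℂ] FieldSpace) (hT : IsLinearCanonicalTransform S T)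
    (Uin Uout : Ω → Plane → ℂ)
    (hUin : MemLp (Function.uncurry Uin) 2 (P.prod volume))
    (hUout : AEStronglyMeasurable (Function.uncurry Uout) (P.prod volume))
    (hprop : ∀ᵐ ω ∂P, ∃ h : MemLp (Uin ω) 2 volume, Uout ω =ᵐ[volume] T (h.toLp (Uin ω)))
    (ξ : PhaseSpace) :
    wignerDistribution (crossSpectralDensity P Uout) ξ =
      wignerDistribution (crossSpectralDensity P Uin) (S⁻¹.mulVec ξ) := by
  rw [wignerDistribution_crossSpectralDensity hUin, wignerDistribution_crossSpectralDensity
    (memLp_uncurry_of_bounded_operator T hUin hUout hprop)]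
  refine integral_congr_ae ?_
  filter_upwards [hprop] with ω ⟨h, hω⟩
  rw [coherentWigner_congr_ae hω, hT.coherentWigner_eq, coherentWigner_congr_ae h.coeFn_toLp]
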